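/- Let $m,n$ denote positive integers. A $(2m,n)$-dimensional Clifford system is an $n$-tuple $(P_1,\dots,P_n)$ of symmetric endomorphisms of $\mathbb R^{2m}$ with $P_iP_j+P_jP_i=2\delta_{ij}\,\mathrm{Id}$ for all $i,j$; an $(m,n)$-dimensional O-system is an $n$-tuple $(\tau_1,\dots,\tau_n)$ of orthogonal endomorphisms of $\mathbb R^m$ with $\tau_i^t\tau_j+\tau_j^t\tau_i=2\delta_{ij}\,\mathrm{Id}$ for all $i,j$. Write $C(2m,n)$ and $O(m,n)$ for the sets of these systems. An element of $C(2m,n)$ (respectively $O(m,n)$) is called range-maximal if, for the fixed $m$, $n$ is the largest integer for which this set is non-empty, and domain-minimal if, for the fixed $n$, $m$ is the smallest positive integer for which this set is non-empty. A) Every positive integer $m$ can be written uniquely as $m=(2r+1)2^{c+4d}$ with integers $r,d\ge 0$ and $0\le c\le 3$; put $\sigma(m)=2^c+8d$. Then for every $m\ge 1$ there exist range-maximal $(m,\sigma(m))$-dimensional O-systems and range-maximal $(2m,\sigma(m)+1)$-dimensional Clifford systems. B) Define $m(n)$ for $n\ge1$ by $m(1),\dots,m(8)=1,2,4,4,8,8,8,8$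 and $m(n+8)=16\,m(n)$. Then for all positive integers $m,n$: a domain-minimal $(2m,n+1)$-dimensional Clifford system exists if and only if $m=m(n)$, and a domain-minimal $(m,n)$-dimensional O-system exists if and only if $m=m(n)$. -/

import Mathlib

/-- The Euclidean space `ℝ^k`. -/
abbrev Euc (k : ℕ) : Type := EuclideanSpace ℝ (Fin k)

/-- The set `C(2m, n)` of `(2m, n)`-dimensional Clifford systems: `n`-tuples of symmetric
endomorphisms of `ℝ^(2m)` with `P i P j + P j P i = 2 δ_ij Id`. -/
def CliffordSystems (m n : ℕ) : Set (Fin n → (Euc (2 * m) →ₗ[ℝ] Euc (2 * m))) :=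
  {P | (∀ i, (P i).IsSymmetric) ∧
    ∀ i j, P i ∘ₗ P j + P j ∘ₗ P i = (if i = j then (2 : ℝ) else 0) • LinearMap.id}

/-- The set `O(m, n)` of `(m, n)`-dimensional O-systems: `n`-tuples of orthogonal
endomorphisms of `ℝ^m` with `(τ i)ᵗ τ j + (τ j)ᵗ τ i = 2 δ_ij Id`. -/
def OSystems (m n : ℕ) : Set (Fin n → (Euc m →ₗ[ℝ] Euc m)) :=
  {τ | (∀ i, LinearMap.adjoint (τ i) ∘ₗ τ i = LinearMap.id ∧
      τ i ∘ₗ LinearMap.adjoint (τ i) = LinearMap.id) ∧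
    ∀ i j, LinearMap.adjoint (τ i) ∘ₗ τ j + LinearMap.adjoint (τ j) ∘ₗ τ i
      = (if i = j then (2 : ℝ) else 0) • LinearMap.id}

/-- `P` is a range-maximal `(2m, n)`-dimensional Clifford system: for fixed `m`, the number `n`
is the largest one with `C(2m, n)` nonempty. -/
def IsRangeMaximalClifford (m n : ℕ) (P : Fin n → (Euc (2 * m) →ₗ[ℝ] Euc (2 * m))) : Prop :=
  P ∈ CliffordSystems m n ∧ ∀ k : ℕ, (CliffordSystems m k).Nonempty → k ≤ n

/-- `τ` is a range-maximal `(m, n)`-dimensional O-system: for fixed `m`, the number `n`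
is the largest one with `O(m, n)` nonempty. -/
def IsRangeMaximalO (m n : ℕ) (τ : Fin n → (Euc m →ₗ[ℝ] Euc m)) : Prop :=
  τ ∈ OSystems m n ∧ ∀ k : ℕ, (OSystems m k).Nonempty → k ≤ n

/-- `P` is a domain-minimal `(2m, n)`-dimensional Clifford system: for fixed `n`, the dimension
`2m` is the smallest positive one with `C(2m, n)` nonempty. -/
def IsDomainMinimalClifford (m n : ℕ) (P : Fin n → (Euc (2 * m) →ₗ[ℝ] Euc (2 * m))) : Prop :=
  0 < m ∧ P ∈ CliffordSystems m n ∧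
    ∀ l : ℕ, 0 < l → (CliffordSystems l n).Nonempty → 2 * m ≤ 2 * l

/-- `τ` is a domain-minimal `(m, n)`-dimensional O-system: for fixed `n`, the dimension `m` is
the smallest positive one with `O(m, n)` nonempty. -/
def IsDomainMinimalO (m n : ℕ) (τ : Fin n → (Euc m →ₗ[ℝ] Euc m)) : Prop :=
  0 < m ∧ τ ∈ OSystems m n ∧ ∀ l : ℕ, 0 < l → (OSystems l n).Nonempty → m ≤ l

/-- The table of the numbers `m(n)` for `n ≥ 1`: the values `1, 2, 4, 4, 8, 8, 8, 8` for
`n = 1, …, 8`, continued by `m(n + 8) = 16 m(n)`. The value at `n = 0` is a placeholder. -/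
def tableM : ℕ → ℕ
  | 0 => 0
  | 1 => 1
  | 2 => 2
  | 3 => 4
  | 4 => 4
  | 5 => 8
  | 6 => 8
  | 7 => 8
  | 8 => 8
  | n + 9 => 16 * tableM (n + 1)

open Module

/-! Both existence questions reduce to one: in which dimensions do `n` anticommuting complex
structures exist? For an O-system take `τ₀ᵗ τᵢ`; for a Clifford system take `P₁ Pᵢ` on the
`1`-eigenspace of `P₀`, which has half the dimension. The answer is that `tableM (n + 1)` divides
the dimension (`oSystems_nonempty_iff`, `cliffordSystems_nonempty_iff`), and the theorem is then
arithmetic of the table.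

Both directions work with mixed lists: `p` elements of square `-1` and `q` of square `1`, all
anticommuting. Multiplying four elements of equal sign by their product reverses that sign. A pair
of opposite signs can be removed while halving the dimension, or added while doubling it. Hence
eight complex structures account for a factor `16`, which is the periodicity of the table; the first
eight entries come from determinants, quaternions and one eigenspace compression. -/

/-- Two elements of a ring anticommute. -/
def AntiCommute {A : Type*} [Ring A] (x y : A) : Prop := x * y = -(y * x)

/-! ### Sign rules for products -/

namespace AntiCommute

variable {A : Type*} [Ring A] {x y z : A}

theorem symm (h : AntiCommute x y) : AntiCommute y x := by
  unfold AntiCommute at *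
  rw [h, neg_neg]

theorem mul_right (h : AntiCommute x y) (h' : AntiCommute x z) : Commute x (y * z) := by
  unfold AntiCommute at *
  rw [Commute, SemiconjBy, ← mul_assoc, h, neg_mul, mul_assoc, h', mul_neg, neg_neg, mul_assoc]

theorem mul_right_of_commute (h : AntiCommute x y) (h' : Commute x z) :
    AntiCommute x (y * z) := by
  unfold AntiCommute at *
  rw [← mul_assoc, h, neg_mul, mul_assoc, h'.eq, mul_assoc]

theorem commute_mul_right (h : Commute x y) (h' : AntiCommute x z) :
    AntiCommute x (y * z) := by
  unfold AntiCommute at *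
  rw [← mul_assoc, h.eq, mul_assoc, h', mul_neg, mul_assoc]

theorem mul_self_mul (h : AntiCommute x y) : x * y * (x * y) = -(x * x * (y * y)) := by
  rw [mul_assoc, ← mul_assoc y, h.symm]
  simp only [neg_mul, mul_neg, mul_assoc]

/-- Multiplying by an involution that anticommutes with both factors preserves
anticommutation. -/
theorem mul_mul (h : AntiCommute x y) (hx : AntiCommute x z) (hy : AntiCommute y z) :
    AntiCommute (x * z) (y * z) := by
  have hz : Commute y (z * z) := hy.mul_right hy
  unfold AntiCommute at *
  have h1 : x * z * (y * z) = -(x * y * (z * z)) := by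
    rw [mul_assoc, ← mul_assoc z, ← neg_eq_iff_eq_neg.mpr hy]
    simp only [neg_mul, mul_neg, mul_assoc]
  have h2 : y * z * (x * z) = -(y * x * (z * z)) := by
    rw [mul_assoc, ← mul_assoc z, ← neg_eq_iff_eq_neg.mpr hx]
    simp only [neg_mul, mul_neg, mul_assoc]
  rw [h1, h2, h]
  simp

end AntiCommute

/-! ### Clifford lists and the reversal of four signs -/

/-- The product of four pairwise anticommuting elements whose squares agree and are `1` or `-1`
squares to `1`. -/
theorem fourfold_product_sq {A : Type*} [Ring A] {a b c d s : A} (hs : s = 1 ∨ s = -1)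
    (ha : a * a = s) (hb : b * b = s) (hc : c * c = s) (hd : d * d = s)
    (hab : AntiCommute a b) (hac : AntiCommute a c) (had : AntiCommute a d)
    (hbc : AntiCommute b c) (hbd : AntiCommute b d) (hcd : AntiCommute c d) :
    (a * b * (c * d)) * (a * b * (c * d)) = 1 := by
  have h : Commute (a * b) (c * d) :=
    (hac.mul_right had).mul_left (hbc.mul_right hbd)
  rw [h.symm.mul_mul_mul_comm, hab.mul_self_mul, hcd.mul_self_mul, ha, hb, hc, hd]
  rcases hs with rfl | rfl <;> simp

/-- The elements of `L` square to `-1`, those of `M` square to `1`, and all of them pairwise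
anticommute. -/
structure CliffordLists {A : Type*} [Ring A] (L M : List A) : Prop where
  sq_neg : ∀ x ∈ L, x * x = -1
  sq_pos : ∀ x ∈ M, x * x = 1
  anti_neg : L.Pairwise AntiCommute
  anti_pos : M.Pairwise AntiCommute
  anti : ∀ x ∈ L, ∀ y ∈ M, AntiCommute x y

/-- The elements of `L` are skew and those of `M` are self-adjoint. -/
structure StarLists {A : Type*} [Ring A] [StarRing A] (L M : List A) : Prop where
  skew : ∀ x ∈ L, star x = -x
  symm : ∀ x ∈ M, star x = x

namespace CliffordLists

variable {A : Type*} [Ring A]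

/-- The data shared by the two directions of the sign flip: multiplication of four anticommuting
elements by their product. -/
theorem flip_aux {a b c d s : A} (hs : s = 1 ∨ s = -1)
    (hsq : ∀ x ∈ [a, b, c, d], x * x = s) (hanti : [a, b, c, d].Pairwise AntiCommute)
    {η : A} (hη : η = a * b * (c * d)) :
    (∀ x ∈ [a, b, c, d].map (· * η), x * x = -s) ∧
    ([a, b, c, d].map (· * η)).Pairwise AntiCommute ∧
    (∀ y : A, (∀ x ∈ [a, b, c, d], AntiCommute y x) →
      ∀ x ∈ [a, b, c, d].map (· * η), AntiCommute y x) ∧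
    (∀ x ∈ [a, b, c, d], AntiCommute x η) := by
  simp only [List.pairwise_cons, List.mem_cons, List.not_mem_nil, or_false, forall_eq_or_imp,
    forall_eq, IsEmpty.forall_iff, implies_true, and_true, List.Pairwise.nil] at hsq hanti
  obtain ⟨ha, hb, hc, hd⟩ := hsq
  obtain ⟨⟨hab, hac, had⟩, ⟨hbc, hbd⟩, hcd⟩ := hanti
  have h1 : η * η = 1 := by
    rw [hη]; exact fourfold_product_sq hs ha hb hc hd hab hac had hbc hbd hcd
  have haη : AntiCommute a η := hη ▸
    (AntiCommute.commute_mul_right (Commute.refl a) hab).mul_right_of_commute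
      (hac.mul_right had)
  have hbη : AntiCommute b η := hη ▸
    (hab.symm.mul_right_of_commute (Commute.refl b)).mul_right_of_commute (hbc.mul_right hbd)
  have hcη : AntiCommute c η := hη ▸
    AntiCommute.commute_mul_right (hac.symm.mul_right hbc.symm)
      (AntiCommute.commute_mul_right (Commute.refl c) hcd)
  have hdη : AntiCommute d η := hη ▸
    AntiCommute.commute_mul_right (had.symm.mul_right hbd.symm)
      (hcd.symm.mul_right_of_commute (Commute.refl d))
  have hsq' : ∀ x : A, AntiCommute x η → x * x = s → x * η * (x * η) = -s := by
    intro x hx hxs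
    rw [hx.mul_self_mul, h1, hxs, mul_one]
  simp only [List.map_cons, List.map_nil, List.pairwise_cons, List.mem_cons, List.not_mem_nil,
    or_false, forall_eq_or_imp, forall_eq, IsEmpty.forall_iff, implies_true, and_true,
    List.Pairwise.nil]
  refine ⟨⟨hsq' a haη ha, hsq' b hbη hb, hsq' c hcη hc, hsq' d hdη hd⟩,
    ⟨⟨hab.mul_mul haη hbη, hac.mul_mul haη hcη, had.mul_mul haη hdη⟩,
      ⟨hbc.mul_mul hbη hcη, hbd.mul_mul hbη hdη⟩, hcd.mul_mul hcη hdη⟩, ?_, haη, hbη, hcη, hdη⟩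
  rintro y ⟨ya, yb, yc, yd⟩
  -- Passing four factors costs an even number of signs, so outside elements commute with `η`; each
  -- of the four factors itself passes only three others, an odd number.
  have hy : Commute y η := hη ▸ (ya.mul_right yb).mul_right (yc.mul_right yd)
  exact ⟨ya.mul_right_of_commute hy, yb.mul_right_of_commute hy, yc.mul_right_of_commute hy,
    yd.mul_right_of_commute hy⟩

theorem flip_neg {a b c d : A} {L M : List A} (h : CliffordLists ([a, b, c, d] ++ L) M) :
    CliffordLists L ([a, b, c, d].map (· * (a * b * (c * d))) ++ M) := by
  obtain ⟨h1, h2, h3, h4, h5⟩ := h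
  rw [List.pairwise_append] at h3
  obtain ⟨k1, k2, k3, -⟩ := flip_aux (Or.inr rfl)
    (fun x hx => h1 x (List.mem_append_left _ hx)) h3.1 rfl
  refine ⟨fun x hx => h1 x (List.mem_append_right _ hx), ?_, h3.2.1, ?_, ?_⟩
  · intro x hx
    rcases List.mem_append.1 hx with hx | hx
    · rw [k1 x hx, neg_neg]
    · exact h2 x hx
  · rw [List.pairwise_append]
    exact ⟨k2, h4, fun x hx y hy =>
      (k3 y (fun z hz => (h5 z (List.mem_append_left _ hz) y hy).symm) x hx).symm⟩
  · intro x hx y hy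
    rcases List.mem_append.1 hy with hy | hy
    · exact k3 x (fun z hz => (h3.2.2 z hz x hx).symm) y hy
    · exact h5 x (List.mem_append_right _ hx) y hy

theorem flip_pos {a b c d : A} {L M : List A} (h : CliffordLists L ([a, b, c, d] ++ M)) :
    CliffordLists ([a, b, c, d].map (· * (a * b * (c * d))) ++ L) M := by
  obtain ⟨h1, h2, h3, h4, h5⟩ := h
  rw [List.pairwise_append] at h4
  obtain ⟨k1, k2, k3, -⟩ := flip_aux (Or.inl rfl)
    (fun x hx => h2 x (List.mem_append_left _ hx)) h4.1 rfl
  refine ⟨?_, fun x hx => h2 x (List.mem_append_right _ hx), ?_, h4.2.1, ?_⟩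
  · intro x hx
    rcases List.mem_append.1 hx with hx | hx
    · rw [k1 x hx]
    · exact h1 x hx
  · rw [List.pairwise_append]
    exact ⟨k2, h3, fun x hx y hy =>
      (k3 y (fun z hz => h5 y hy z (List.mem_append_left _ hz)) x hx).symm⟩
  · intro x hx y hy
    rcases List.mem_append.1 hx with hx | hx
    · exact (k3 y (fun z hz => (h4.2.2 z hz y hy).symm) x hx).symm
    · exact h5 x hx y (List.mem_append_right _ hy)

/-- The product `η` of the four is self-adjoint, because the signs from reversing `ab` and `cd`
cancel. As `x` anticommutes with `η`, the adjoint of `x η` is `η x = -x η`. -/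
theorem star_flip_pos [StarRing A] {a b c d : A} {L M : List A}
    (h : CliffordLists L ([a, b, c, d] ++ M)) (hs : StarLists L ([a, b, c, d] ++ M)) :
    StarLists ([a, b, c, d].map (· * (a * b * (c * d))) ++ L) M := by
  obtain ⟨-, h2, -, h4, -⟩ := h
  rw [List.pairwise_append] at h4
  obtain ⟨-, -, -, k4⟩ := flip_aux (Or.inl rfl)
    (fun x hx => h2 x (List.mem_append_left _ hx)) h4.1 rfl
  have hsym : ∀ x ∈ [a, b, c, d], star x = x := fun x hx =>
    hs.symm x (List.mem_append_left _ hx)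
  have hη : star (a * b * (c * d)) = a * b * (c * d) := by
    have h := h4.1
    simp only [List.pairwise_cons, List.mem_cons, List.not_mem_nil, or_false, forall_eq_or_imp,
      forall_eq, IsEmpty.forall_iff, implies_true, and_true, List.Pairwise.nil] at h hsym
    obtain ⟨⟨hab, hac, had⟩, ⟨hbc, hbd⟩, hcd⟩ := h
    have hcomm : Commute (a * b) (c * d) := (hac.mul_right had).mul_left (hbc.mul_right hbd)
    rw [star_mul, star_mul, star_mul, hsym.1, hsym.2.1, hsym.2.2.1, hsym.2.2.2,
      hab.symm, hcd.symm, neg_mul_neg, hcomm.eq]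
  refine ⟨?_, fun x hx => hs.symm x (List.mem_append_right _ hx)⟩
  intro x hx
  rcases List.mem_append.1 hx with hx | hx
  · obtain ⟨y, hy, rfl⟩ := List.mem_map.1 hx
    rw [star_mul, hη, hsym y hy, (k4 y hy).symm]
  · exact hs.skew x hx

end CliffordLists

/-! ### Eigenspace compression and divisibility of the dimension -/

/-- Compression to the `1`-eigenspace of an involution `g`. If some unit anticommutes with `g`,
the eigenspace has half the dimension. -/
theorem exists_compression {V : Type*} [AddCommGroup V] [Module ℝ V] [FiniteDimensional ℝ V]
    {g A : End ℝ V} (hg : g * g = 1) (hA : IsUnit A) (hgA : AntiCommute A g) :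
    ∃ (W : Submodule ℝ V) (r : End ℝ V →ₗ[ℝ] End ℝ W), finrank ℝ V = 2 * finrank ℝ W ∧
      r 1 = 1 ∧ ∀ x y, Commute y g → r (x * y) = r x * r y := by
  have hgg : ∀ v, g (g v) = v := fun v => LinearMap.congr_fun hg v
  have hAg : ∀ v, A (g v) = -g (A v) := fun v => LinearMap.congr_fun hgA v
  let W : Submodule ℝ V := LinearMap.ker (g - 1)
  have hW : ∀ v, v ∈ W ↔ g v = v := fun v => by
    simp [W, sub_eq_zero]
  let p : V →ₗ[ℝ] W := LinearMap.codRestrict W ((1 / 2 : ℝ) • (1 + g)) fun v => by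
    rw [hW]
    simp [hgg, add_comm]
  have hp : ∀ v, (p v : V) = (1 / 2 : ℝ) • (v + g v) := fun v => rfl
  have hpW : ∀ w : W, p w = w := fun w => by
    apply Subtype.ext
    rw [hp, (hW w).1 w.2, ← two_smul ℝ, smul_smul]
    norm_num
  obtain ⟨u, rfl⟩ := hA
  set B : End ℝ V := ((u⁻¹ : (End ℝ V)ˣ) : End ℝ V) with hB
  have hAB : ∀ v, (u : End ℝ V) (B v) = v := fun v => LinearMap.congr_fun (u.mul_inv) v
  have hBA : ∀ v, B ((u : End ℝ V) v) = v := fun v => LinearMap.congr_fun (u.inv_mul) v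
  have hBg : ∀ v, B (g v) = -g (B v) := fun v => by
    have := hAg (B v)
    rw [hAB] at this
    rw [eq_neg_iff_add_eq_zero, ← neg_eq_iff_eq_neg.2 this, map_neg, hBA, neg_add_cancel]
  -- The unit interchanges the two eigenspaces of `g`, so `V = W ⊕ A W`.
  let e : V ≃ₗ[ℝ] W × W :=
    LinearEquiv.ofLinearMap (p.prod (p ∘ₗ B)) (W.subtype.coprod (u.1 ∘ₗ W.subtype))
      (by
        apply LinearMap.ext
        rintro ⟨w, w'⟩
        have h1 : p ((u : End ℝ V) w') = 0 := Subtype.ext <| by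
          have h := hAg w'
          rw [(hW w').1 w'.2] at h
          rw [hp, h]
          simp [← neg_eq_iff_eq_neg.2 h]
        have h2 : p (B w) = 0 := Subtype.ext <| by
          have h := hBg w
          rw [(hW w).1 w.2] at h
          rw [hp, h]
          simp [← neg_eq_iff_eq_neg.2 h]
        apply Prod.ext
        · simp [hpW, h1]
        · simp [hpW, h2, hBA])
      (by
        apply LinearMap.ext
        intro v
        change (p v : V) + (u : End ℝ V) (p (B v) : V) = v
        rw [hp, hp, map_smul, map_add, hAB]
        have h := hAg (B v)
        rw [hAB] at h
        rw [h, ← smul_add, add_add_add_comm, add_neg_cancel, add_zero, ← two_smul ℝ, smul_smul]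
        norm_num)
  -- `r x` is `x` restricted to `W` and projected back; the projection is harmless after any `y`
  -- that preserves `W`.
  refine ⟨W, LinearMap.lcomp ℝ W W.subtype ∘ₗ LinearMap.llcomp ℝ V V W p, ?_, ?_, ?_⟩
  · rw [e.finrank_eq, finrank_prod, two_mul]
  · apply LinearMap.ext
    intro w
    exact hpW w
  · intro x y hy
    apply LinearMap.ext
    intro w
    have h : y w ∈ W := by
      rw [hW]
      have := LinearMap.congr_fun hy.eq (w : V)
      simp only [Module.End.mul_apply, (hW w).1 w.2] at this
      exact this.symm
    change p (x (y w)) = p (x (p (y w)))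
    rw [show ((p (y w) : W) : V) = y w from congrArg Subtype.val (hpW ⟨_, h⟩)]

namespace CliffordLists

/-- A linear map that is multiplicative on the listed elements transports Clifford lists. -/
theorem map {A B : Type*} [Ring A] [Ring B] {L M : List A} (h : CliffordLists L M)
    (r : A →+ B) (h1 : r 1 = 1) (hr : ∀ x ∈ L ++ M, ∀ y ∈ L ++ M, r (x * y) = r x * r y) :
    CliffordLists (L.map r) (M.map r) := by
  obtain ⟨k1, k2, k3, k4, k5⟩ := h
  have hanti : ∀ x ∈ L ++ M, ∀ y ∈ L ++ M, AntiCommute x y → AntiCommute (r x) (r y) := by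
    intro x hx y hy hxy
    unfold AntiCommute at *
    rw [← hr x hx y hy, ← hr y hy x hx, hxy, map_neg]
  have hL : ∀ x ∈ L, x ∈ L ++ M := fun x hx => List.mem_append_left _ hx
  have hM : ∀ x ∈ M, x ∈ L ++ M := fun x hx => List.mem_append_right _ hx
  constructor
  · simp only [List.mem_map]
    rintro _ ⟨x, hx, rfl⟩
    rw [← hr x (hL x hx) x (hL x hx), k1 x hx, map_neg, h1]
  · simp only [List.mem_map]
    rintro _ ⟨x, hx, rfl⟩
    rw [← hr x (hM x hx) x (hM x hx), k2 x hx, h1]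
  · rw [List.pairwise_map]
    exact k3.imp_of_mem fun {a b} ha hb h => hanti a (hL a ha) b (hL b hb) h
  · rw [List.pairwise_map]
    exact k4.imp_of_mem fun {a b} ha hb h => hanti a (hM a ha) b (hM b hb) h
  · simp only [List.mem_map]
    rintro _ ⟨x, hx, rfl⟩ _ ⟨y, hy, rfl⟩
    exact hanti x (hL x hx) y (hM y hy) (k5 x hx y hy)

variable {V : Type} [AddCommGroup V] [Module ℝ V]

/-- The involution `g j` anticommutes with `g` and commutes with every other listed element, so
these restrict to its `1`-eigenspace. -/
theorem exists_halving [FiniteDimensional ℝ V] {j g : End ℝ V} {L M : List (End ℝ V)}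
    (h : CliffordLists (j :: L) (g :: M)) :
    ∃ (W : Type) (_ : AddCommGroup W) (_ : Module ℝ W) (_ : FiniteDimensional ℝ W)
      (r : End ℝ V → End ℝ W), finrank ℝ V = 2 * finrank ℝ W ∧
      CliffordLists (L.map r) (M.map r) := by
  obtain ⟨k1, k2, k3, k4, k5⟩ := h
  rw [List.pairwise_cons] at k3 k4
  have hj : j * j = -1 := k1 j (by simp)
  have hg : g * g = 1 := k2 g (by simp)
  have hjg : AntiCommute j g := k5 j (by simp) g (by simp)
  have hh : (g * j) * (g * j) = 1 := by rw [hjg.symm.mul_self_mul, hg, hj]; simp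
  have hu : IsUnit g := ⟨⟨g, g, hg, hg⟩, rfl⟩
  obtain ⟨W, r, h1, h2, h3⟩ := exists_compression hh hu
    (AntiCommute.commute_mul_right (Commute.refl g) hjg.symm)
  have hrest : CliffordLists L M := ⟨fun x hx => k1 x (List.mem_cons_of_mem _ hx),
    fun x hx => k2 x (List.mem_cons_of_mem _ hx), k3.2, k4.2,
    fun x hx y hy => k5 x (List.mem_cons_of_mem _ hx) y (List.mem_cons_of_mem _ hy)⟩
  refine ⟨W, inferInstance, inferInstance, inferInstance, r, h1,
    hrest.map r.toAddMonoidHom h2 fun x _ y hy => h3 x y ?_⟩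
  rcases List.mem_append.1 hy with hy | hy
  · exact (k5 y (List.mem_cons_of_mem _ hy) g (by simp)).mul_right (k3.1 y hy).symm
  · exact (k4.1 y hy).symm.mul_right (k5 j (by simp) y (List.mem_cons_of_mem _ hy)).symm

/-- `(det a)² = (-1)^dim V` cannot be negative. -/
theorem two_dvd_finrank {a : End ℝ V} {L M : List (End ℝ V)} (h : CliffordLists (a :: L) M) :
    2 ∣ finrank ℝ V := by
  have ha := congrArg LinearMap.det (h.sq_neg a (by simp))
  have h1 : (-1 : End ℝ V) = (-1 : ℝ) • (1 : End ℝ V) := by simp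
  rw [h1, LinearMap.det_smul, map_mul, map_one, mul_one] at ha
  by_contra hodd
  rw [← even_iff_two_dvd, Nat.not_even_iff_odd] at hodd
  rw [hodd.neg_one_pow] at ha
  nlinarith [mul_self_nonneg (LinearMap.det a)]

/-- `a` and `b` make `V` a vector space over the quaternions. -/
theorem four_dvd_finrank {a b : End ℝ V} {L M : List (End ℝ V)}
    (h : CliffordLists (a :: b :: L) M) : 4 ∣ finrank ℝ V := by
  have hab : AntiCommute a b := (List.pairwise_cons.1 h.anti_neg).1 b (by simp)
  let q : QuaternionAlgebra.Basis (End ℝ V) (-1 : ℝ) 0 (-1) :=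
    { i := a, j := b, k := a * b
      i_mul_i := by simp [h.sq_neg a]
      j_mul_j := by simp [h.sq_neg b]
      i_mul_j := rfl
      j_mul_i := by rw [hab.symm]; simp }
  let f : Quaternion ℝ →ₐ[ℝ] End ℝ V := q.liftHom
  let _ : Module (Quaternion ℝ) V := Module.compHom V f.toRingHom
  have : IsScalarTower ℝ (Quaternion ℝ) V := ⟨fun s x v => by
    change f (s • x) v = s • f x v
    rw [map_smul, LinearMap.smul_apply]⟩
  have := Module.finrank_mul_finrank ℝ (Quaternion ℝ) V
  rw [Quaternion.finrank_eq_four] at this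
  exact ⟨_, this.symm⟩

/-- `abc` is an involution that anticommutes with `d`, so its `1`-eigenspace has half the dimension.
It commutes with `a` and `b`, so this eigenspace is quaternionic. -/
theorem eight_dvd_finrank [FiniteDimensional ℝ V] {a b c d : End ℝ V} {L M : List (End ℝ V)}
    (h : CliffordLists (a :: b :: c :: d :: L) M) : 8 ∣ finrank ℝ V := by
  obtain ⟨k1, -, k3, -, -⟩ := h
  simp only [List.pairwise_cons, List.mem_cons, forall_eq_or_imp] at k1 k3
  obtain ⟨ha, hb, hc, hd, -⟩ := k1
  obtain ⟨⟨hab, hac, had, -⟩, ⟨hbc, hbd, -⟩, ⟨hcd, -⟩, -⟩ := k3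
  have hc' : Commute (a * b) c := (hac.symm.mul_right hbc.symm).symm
  have hg : a * b * c * (a * b * c) = 1 := by
    rw [hc'.symm.mul_mul_mul_comm, hab.mul_self_mul, ha, hb, hc]; simp
  have hu : IsUnit d := ⟨⟨d, -d, by simp [hd], by simp [hd]⟩, rfl⟩
  obtain ⟨W, r, h1, h2, h3⟩ := exists_compression hg hu
    (AntiCommute.commute_mul_right (had.symm.mul_right hbd.symm) hcd.symm)
  have hag : Commute a (a * b * c) := by
    rw [mul_assoc]; exact (Commute.refl a).mul_right (hab.mul_right hac)
  have hbg : Commute b (a * b * c) :=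
    (hab.symm.mul_right_of_commute (Commute.refl b)).mul_right hbc
  have hL : CliffordLists [a, b] [] := ⟨by simp [ha, hb], by simp, by simp [hab], by simp, by simp⟩
  have hW := hL.map r.toAddMonoidHom h2 fun x _ y hy => h3 x y (by
    simp only [List.append_nil, List.mem_cons, List.not_mem_nil, or_false] at hy
    rcases hy with rfl | rfl
    exacts [hag, hbg])
  rw [h1]
  exact Nat.mul_dvd_mul_left 2 (four_dvd_finrank (a := r a) (b := r b) (L := []) (M := []) hW)

/-- Reversing the signs of `a, b, c, d` gives four partners for `a', b', c', d'`; each of the four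
pairs is removed by a halving. -/
theorem exists_periodicity [FiniteDimensional ℝ V] {a b c d a' b' c' d' : End ℝ V} {L : List (End ℝ V)}
    (h : CliffordLists ([a, b, c, d] ++ (a' :: b' :: c' :: d' :: L)) []) :
    ∃ (W : Type) (_ : AddCommGroup W) (_ : Module ℝ W) (_ : FiniteDimensional ℝ W)
      (L' : List (End ℝ W)), finrank ℝ V = 16 * finrank ℝ W ∧ L'.length = L.length ∧
      CliffordLists L' [] := by
  obtain ⟨W₁, _, _, _, r₁, e₁, h₁⟩ := exists_halving h.flip_neg
  obtain ⟨W₂, _, _, _, r₂, e₂, h₂⟩ := exists_halving h₁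
  obtain ⟨W₃, _, _, _, r₃, e₃, h₃⟩ := exists_halving h₂
  obtain ⟨W₄, _, _, _, r₄, e₄, h₄⟩ := exists_halving h₃
  exact ⟨W₄, _, _, ‹_›, _, by rw [e₁, e₂, e₃, e₄]; ring, by simp, h₄⟩

end CliffordLists

theorem CliffordLists.tableM_dvd_finrank (n : ℕ) : ∀ {V : Type} [AddCommGroup V] [Module ℝ V]
    [FiniteDimensional ℝ V] {L : List (End ℝ V)}, CliffordLists L [] → L.length = n →
    tableM (n + 1) ∣ finrank ℝ V := by
  induction n using Nat.strong_induction_on with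
  | _ n ih =>
    intro V _ _ _ L h hn
    match L, h, hn with
    | [], h, hn => subst hn; exact one_dvd _
    | [a], h, hn => subst hn; exact h.two_dvd_finrank
    | [a, b], h, hn => subst hn; exact h.four_dvd_finrank
    | [a, b, c], h, hn => subst hn; exact h.four_dvd_finrank
    | [a, b, c, d], h, hn => subst hn; exact h.eight_dvd_finrank
    | [a, b, c, d, _], h, hn => subst hn; exact h.eight_dvd_finrank
    | [a, b, c, d, _, _], h, hn => subst hn; exact h.eight_dvd_finrank
    | [a, b, c, d, _, _, _], h, hn => subst hn; exact h.eight_dvd_finrank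
    | a :: b :: c :: d :: a' :: b' :: c' :: d' :: L, h, hn =>
      obtain ⟨W, _, _, _, L', e, hlen, h'⟩ := exists_periodicity h
      subst hn
      rw [e]
      exact Nat.mul_dvd_mul_left 16 (ih L.length (by simp; omega) h' hlen)

/-! ### Construction of anticommuting matrices -/

/-- There are `p` skew and `q` symmetric real orthogonal matrices of size `N` that pairwise
anticommute. -/
def HasCliffordMatrices (p q N : ℕ) : Prop :=
  ∃ (ι : Type) (_ : Fintype ι) (_ : DecidableEq ι) (L M : List (Matrix ι ι ℝ)),
    Fintype.card ι = N ∧ L.length = p ∧ M.length = q ∧ CliffordLists L M ∧ StarLists L M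

namespace HasCliffordMatrices

theorem zero_one (k : ℕ) : HasCliffordMatrices 0 1 k :=
  ⟨Fin k, inferInstance, inferInstance, [], [1], by simp, rfl, rfl,
    ⟨by simp, by simp, by simp, by simp, by simp⟩, ⟨by simp, by simp⟩⟩

theorem mono {p q p' q' N : ℕ} (h : HasCliffordMatrices p q N) (hp : p' ≤ p) (hq : q' ≤ q) :
    HasCliffordMatrices p' q' N := by
  obtain ⟨ι, _, _, L, M, hN, rfl, rfl, h, hs⟩ := h
  refine ⟨ι, _, _, L.take p', M.take q', hN, by simpa, by simpa, ⟨?_, ?_, ?_, ?_, ?_⟩, ⟨?_, ?_⟩⟩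
  · exact fun x hx => h.sq_neg x (List.mem_of_mem_take hx)
  · exact fun x hx => h.sq_pos x (List.mem_of_mem_take hx)
  · exact h.anti_neg.sublist (List.take_sublist _ _)
  · exact h.anti_pos.sublist (List.take_sublist _ _)
  · exact fun x hx y hy => h.anti x (List.mem_of_mem_take hx) y (List.mem_of_mem_take hy)
  · exact fun x hx => hs.skew x (List.mem_of_mem_take hx)
  · exact fun x hx => hs.symm x (List.mem_of_mem_take hx)

theorem flip {p q N : ℕ} (h : HasCliffordMatrices p (q + 4) N) :
    HasCliffordMatrices (p + 4) q N := by
  obtain ⟨ι, _, _, L, M, hN, rfl, hM, h, hs⟩ := h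
  match M, hM, h, hs with
  | a :: b :: c :: d :: M, hM, h, hs =>
    refine ⟨ι, _, _, _, _, hN, ?_, ?_, CliffordLists.flip_pos (M := M) h,
      CliffordLists.star_flip_pos (M := M) h hs⟩
    · simp
    · simpa using hM

open Matrix in
-- The inverse of halving: old matrices become `diag(x, -x)`, which anticommutes with the
-- off-diagonal rotation and swap.
theorem double {p q N : ℕ} (h : HasCliffordMatrices p q N) :
    HasCliffordMatrices (p + 1) (q + 1) (2 * N) := by
  obtain ⟨ι, _, _, L, M, hN, rfl, rfl, ⟨k1, k2, k3, k4, k5⟩, hs⟩ := h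
  let D : Matrix ι ι ℝ → Matrix (ι ⊕ ι) (ι ⊕ ι) ℝ := fun x => fromBlocks x 0 0 (-x)
  have hD : ∀ x y, D x * D y = fromBlocks (x * y) 0 0 (x * y) := fun x y => by
    simp [D, fromBlocks_multiply]
  have hDD : ∀ x y, AntiCommute x y → AntiCommute (D x) (D y) := fun x y h => by
    unfold AntiCommute at *
    rw [hD, hD, h, fromBlocks_neg, neg_zero]
  have hJ : ∀ x, AntiCommute (fromBlocks 0 (-1) 1 0) (D x) := fun x => by
    simp [AntiCommute, D, fromBlocks_multiply, fromBlocks_neg]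
  have hG : ∀ x, AntiCommute (fromBlocks 0 1 1 0) (D x) := fun x => by
    simp [AntiCommute, D, fromBlocks_multiply, fromBlocks_neg]
  have hJG : AntiCommute (fromBlocks 0 (-1) 1 0) (fromBlocks 0 1 1 0 :
      Matrix (ι ⊕ ι) (ι ⊕ ι) ℝ) := by
    simp [AntiCommute, fromBlocks_multiply, fromBlocks_neg]
  have hDstar : ∀ x, star (D x) = D (star x) := fun x => by
    simp [D, star_eq_conjTranspose, fromBlocks_transpose]
  have hDneg : ∀ x, D (-x) = - D x := fun x => by simp [D, fromBlocks_neg]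
  refine ⟨ι ⊕ ι, inferInstance, inferInstance, fromBlocks 0 (-1) 1 0 :: L.map D,
    fromBlocks 0 1 1 0 :: M.map D, by simp [hN, two_mul], by simp, by simp,
    ⟨?_, ?_, ?_, ?_, ?_⟩, ⟨?_, ?_⟩⟩
  · simp only [List.mem_cons, List.mem_map, forall_eq_or_imp, forall_exists_index, and_imp,
      forall_apply_eq_imp_iff₂]
    refine ⟨by simp [fromBlocks_multiply, ← fromBlocks_one, fromBlocks_neg], fun x hx => ?_⟩
    rw [hD, k1 x hx, ← fromBlocks_one, fromBlocks_neg, neg_zero]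
  · simp only [List.mem_cons, List.mem_map, forall_eq_or_imp, forall_exists_index, and_imp,
      forall_apply_eq_imp_iff₂]
    refine ⟨by simp [fromBlocks_multiply], fun x hx => ?_⟩
    rw [hD, k2 x hx, fromBlocks_one]
  · rw [List.pairwise_cons, List.pairwise_map]
    simp only [List.mem_map, forall_exists_index, and_imp, forall_apply_eq_imp_iff₂]
    exact ⟨fun x _ => hJ x, k3.imp fun {a b} h => hDD a b h⟩
  · rw [List.pairwise_cons, List.pairwise_map]
    simp only [List.mem_map, forall_exists_index, and_imp, forall_apply_eq_imp_iff₂]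
    exact ⟨fun x _ => hG x, k4.imp fun {a b} h => hDD a b h⟩
  · simp only [List.mem_cons, List.mem_map, forall_eq_or_imp, forall_exists_index, and_imp,
      forall_apply_eq_imp_iff₂]
    exact ⟨⟨hJG, fun x _ => hJ x⟩,
      fun x hx => ⟨(hG x).symm, fun y hy => hDD x y (k5 x hx y hy)⟩⟩
  · simp only [List.mem_cons, List.mem_map, forall_eq_or_imp, forall_exists_index, and_imp,
      forall_apply_eq_imp_iff₂]
    refine ⟨by simp [star_eq_conjTranspose, fromBlocks_transpose, fromBlocks_neg],
      fun x hx => ?_⟩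
    rw [hDstar, hs.skew x hx, hDneg]
  · simp only [List.mem_cons, List.mem_map, forall_eq_or_imp, forall_exists_index, and_imp,
      forall_apply_eq_imp_iff₂]
    refine ⟨by simp [star_eq_conjTranspose, fromBlocks_transpose],
      fun x hx => ?_⟩
    rw [hDstar, hs.symm x hx]

/-- `p` anticommuting complex structures of size `N` yield a Clifford system of `p + 2` matrices of
size `2 N`. -/
theorem toSymmetric {p N : ℕ} (h : HasCliffordMatrices p 0 N) :
    HasCliffordMatrices 0 (p + 2) (2 * N) := by
  open Matrix in
  obtain ⟨ι, _, _, L, M, hN, rfl, hM, ⟨k1, -, k3, -, -⟩, hs⟩ := h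
  -- This block matrix is symmetric exactly because `x` is skew.
  let D : Matrix ι ι ℝ → Matrix (ι ⊕ ι) (ι ⊕ ι) ℝ := fun x => fromBlocks 0 (-x) x 0
  have hD : ∀ x y, D x * D y = fromBlocks (-(x * y)) 0 0 (-(x * y)) := fun x y => by
    simp [D, fromBlocks_multiply]
  have hDD : ∀ x y, AntiCommute x y → AntiCommute (D x) (D y) := fun x y h => by
    unfold AntiCommute at *
    rw [hD, hD, h, fromBlocks_neg, neg_zero]
  have hJ : ∀ x, AntiCommute (fromBlocks 1 0 0 (-1)) (D x) := fun x => by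
    simp [AntiCommute, D, fromBlocks_multiply, fromBlocks_neg]
  have hG : ∀ x, AntiCommute (fromBlocks 0 1 1 0) (D x) := fun x => by
    simp [AntiCommute, D, fromBlocks_multiply, fromBlocks_neg]
  have hJG : AntiCommute (fromBlocks 1 0 0 (-1)) (fromBlocks 0 1 1 0 :
      Matrix (ι ⊕ ι) (ι ⊕ ι) ℝ) := by
    simp [AntiCommute, fromBlocks_multiply, fromBlocks_neg]
  refine ⟨ι ⊕ ι, inferInstance, inferInstance, [],
    fromBlocks 1 0 0 (-1) :: fromBlocks 0 1 1 0 :: L.map D, by simp [hN, two_mul], rfl, by simp,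
    ⟨by simp, ?_, List.Pairwise.nil, ?_, by simp⟩, ⟨by simp, ?_⟩⟩
  · simp only [List.mem_cons, List.mem_map, forall_eq_or_imp, forall_exists_index, and_imp,
      forall_apply_eq_imp_iff₂]
    refine ⟨by simp [fromBlocks_multiply], by simp [fromBlocks_multiply], fun x hx => ?_⟩
    rw [hD, k1 x hx, neg_neg, fromBlocks_one]
  · rw [List.pairwise_cons, List.pairwise_cons, List.pairwise_map]
    simp only [List.mem_cons, List.mem_map, forall_eq_or_imp, forall_exists_index, and_imp,
      forall_apply_eq_imp_iff₂]
    exact ⟨⟨hJG, fun x _ => hJ x⟩, fun x _ => hG x, k3.imp fun {a b} h => hDD a b h⟩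
  · simp only [List.mem_cons, List.mem_map, forall_eq_or_imp, forall_exists_index, and_imp,
      forall_apply_eq_imp_iff₂]
    refine ⟨by simp [star_eq_conjTranspose, fromBlocks_transpose],
      by simp [star_eq_conjTranspose, fromBlocks_transpose], fun x hx => ?_⟩
    have h1 : xᵀ = -x := by simpa [star_eq_conjTranspose] using hs.skew x hx
    simp [D, star_eq_conjTranspose, fromBlocks_transpose, h1]

/-- The product of two anticommuting complex structures is a third one. -/
theorem quaternionic {N : ℕ} (h : HasCliffordMatrices 2 0 N) : HasCliffordMatrices 3 0 N := by
  obtain ⟨ι, _, _, L, M, hN, hL, hM, ⟨k1, -, k3, -, -⟩, hs⟩ := h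
  match L, hL, k1, k3, hs with
  | [a, b], _, k1, k3, hs =>
    have ha := k1 a (by simp)
    have hb := k1 b (by simp)
    have hab : AntiCommute a b := (List.pairwise_cons.1 k3).1 b (by simp)
    have haab : AntiCommute a (a * b) := AntiCommute.commute_mul_right (Commute.refl a) hab
    have hbab : AntiCommute b (a * b) := hab.symm.mul_right_of_commute (Commute.refl b)
    refine ⟨ι, inferInstance, inferInstance, [a, b, a * b], [], hN, rfl, rfl,
      ⟨?_, by simp, by simp [hab, haab, hbab], by simp, by simp⟩, ⟨?_, by simp⟩⟩
    · simp [ha, hb, hab.mul_self_mul]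
    · have hsa := hs.skew a (by simp)
      have hsb := hs.skew b (by simp)
      simp only [List.mem_cons, List.not_mem_nil, or_false, forall_eq_or_imp, forall_eq]
      refine ⟨hsa, hsb, ?_⟩
      rw [star_mul, hsa, hsb, neg_mul_neg, hab.symm]

/-- Doubling from the identity of size `k` gives types `(1, 2)`, `(2, 3)`, `(3, 4)`, and a flip of
the last gives `(7, 0)` in size `8 k`. In the periodic step, four doublings and a flip lead from
`(n, 0)` through `(n + 4, 4)` to `(n + 8, 0)`. -/
theorem of_mul_tableM (n k : ℕ) : HasCliffordMatrices n 0 (k * tableM (n + 1)) := by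
  have h2 : HasCliffordMatrices 1 2 (k * 2) := mul_comm 2 k ▸ (zero_one k).double
  have h4 : HasCliffordMatrices 2 3 (k * 4) := by
    have := h2.double
    rwa [show 2 * (k * 2) = k * 4 by ring] at this
  have h8 : HasCliffordMatrices 7 0 (k * 8) := by
    have := h4.double.flip
    rwa [show 2 * (k * 4) = k * 8 by ring] at this
  have h4' : HasCliffordMatrices 3 0 (k * 4) := (h4.mono le_rfl (Nat.zero_le _)).quaternionic
  induction n using Nat.strong_induction_on with
  | _ n ih =>
    match n, ih with
    | 0, _ => simpa [tableM] using (zero_one k).mono le_rfl (Nat.zero_le 1)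
    | 1, _ => exact h2.mono le_rfl (Nat.zero_le _)
    | 2, _ => exact h4'.mono (by norm_num) le_rfl
    | 3, _ => exact h4'
    | 4, _ => exact h8.mono (by norm_num) le_rfl
    | 5, _ => exact h8.mono (by norm_num) le_rfl
    | 6, _ => exact h8.mono (by norm_num) le_rfl
    | 7, _ => exact h8
    | n + 8, ih =>
      have := (ih n (by omega)).double.double.double.double.flip
      rw [show 2 * (2 * (2 * (2 * (k * tableM (n + 1))))) = k * (16 * tableM (n + 1)) by ring]
        at this
      exact this

/-! ### From matrices to systems -/

/-- Matrices indexed by a type with `N` elements act on `ℝ^N`, the transpose as the adjoint. -/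
theorem _root_.Matrix.exists_starAlgEquiv_end_euc {ι : Type} [Fintype ι] [DecidableEq ι] {N : ℕ}
    (h : Fintype.card ι = N) :
    Nonempty (Matrix ι ι ℝ ≃⋆ₐ[ℝ] (Euc N →ₗ[ℝ] Euc N)) :=
  ⟨(LinearMap.toMatrixOrthonormal ((EuclideanSpace.basisFun (Fin N) ℝ).reindex
    (Fintype.equivFinOfCardEq h).symm)).symm⟩

theorem nonempty_cliffordSystems {m n : ℕ} (h : HasCliffordMatrices 0 n (2 * m)) :
    (CliffordSystems m n).Nonempty := by
  obtain ⟨ι, _, _, L, M, hN, hL, rfl, ⟨-, k2, -, k4, -⟩, hs⟩ := h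
  obtain ⟨φ⟩ := Matrix.exists_starAlgEquiv_end_euc hN
  refine ⟨fun i => φ (M.get i), fun i => ?_, fun i j => ?_⟩
  · rw [LinearMap.isSymmetric_iff_isSelfAdjoint, IsSelfAdjoint, ← map_star,
      hs.symm _ (List.get_mem _ _)]
  · rw [← Module.End.mul_eq_comp, ← Module.End.mul_eq_comp, ← map_mul, ← map_mul, ← map_add,
      ← Module.End.one_eq_id, ← map_one φ, ← map_smul]
    congr 1
    have key : ∀ i j, i < j → AntiCommute (M.get i) (M.get j) := List.pairwise_iff_get.1 k4
    rcases lt_trichotomy i j with hij | rfl | hij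
    · rw [key i j hij]; simp [hij.ne]
    · rw [k2 _ (List.get_mem _ _), if_pos rfl, two_smul]
    · rw [key j i hij]; simp [hij.ne']

/-- The identity joins the complex structures as the extra member, whence `n + 1`. -/
theorem nonempty_oSystems {m n : ℕ} (h : HasCliffordMatrices n 0 m) :
    (OSystems m (n + 1)).Nonempty := by
  obtain ⟨ι, _, _, L, M, hN, rfl, hM, ⟨k1, -, k3, -, -⟩, hs⟩ := h
  obtain ⟨φ⟩ := Matrix.exists_starAlgEquiv_end_euc hN
  have hself : ∀ x ∈ 1 :: L, star x * x = 1 ∧ x * star x = 1 := by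
    simp only [List.mem_cons, forall_eq_or_imp, star_one, mul_one, and_self, true_and]
    intro x hx
    rw [hs.skew x hx, neg_mul, mul_neg, k1 x hx, neg_neg, and_self]
  have hpair : (1 :: L).Pairwise fun x y => star x * y + star y * x = 0 := by
    rw [List.pairwise_cons]
    refine ⟨fun x hx => by rw [hs.skew x hx]; simp, k3.imp_of_mem fun {x y} hx hy h => ?_⟩
    rw [hs.skew x hx, hs.skew y hy, neg_mul, neg_mul, h, neg_neg, add_neg_cancel]
  have key := List.pairwise_iff_get.1 hpair
  refine ⟨fun i : Fin (1 :: L).length => φ ((1 :: L).get i), fun i => ?_, fun i j => ?_⟩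
  · rw [← LinearMap.star_eq_adjoint, ← map_star, ← Module.End.mul_eq_comp,
      ← Module.End.mul_eq_comp, ← map_mul, ← map_mul, (hself _ (List.get_mem _ _)).1,
      (hself _ (List.get_mem _ _)).2, map_one]
    exact ⟨rfl, rfl⟩
  · rw [← LinearMap.star_eq_adjoint, ← LinearMap.star_eq_adjoint, ← map_star, ← map_star,
      ← Module.End.mul_eq_comp, ← Module.End.mul_eq_comp, ← map_mul, ← map_mul, ← map_add,
      ← Module.End.one_eq_id, ← map_one φ, ← map_smul]
    congr 1
    rcases lt_trichotomy i j with hij | rfl | hij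
    · rw [key i j hij]; simp [hij.ne]
    · rw [(hself _ (List.get_mem _ _)).1, if_pos rfl, two_smul]
    · rw [add_comm, key j i hij]; simp [hij.ne']

end HasCliffordMatrices

/-! ### From systems to complex structures -/

theorem OSystems.tableM_dvd {m n : ℕ} (h : (OSystems m (n + 1)).Nonempty) :
    tableM (n + 1) ∣ m := by
  obtain ⟨τ, hτ, hanti⟩ := h
  simp only [← LinearMap.star_eq_adjoint, ← Module.End.mul_eq_comp, ← Module.End.one_eq_id]
    at hτ hanti
  have hskew : ∀ i : Fin n, star (τ i.succ) * τ 0 = -(star (τ 0) * τ i.succ) := fun i => by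
    rw [eq_neg_iff_add_eq_zero, hanti, if_neg (Fin.succ_ne_zero i), zero_smul]
  have hprod : ∀ i j : Fin n, star (τ 0) * τ i.succ * (star (τ 0) * τ j.succ)
      = -(star (τ i.succ) * τ j.succ) := fun i j => by
    rw [← neg_eq_iff_eq_neg.2 (hskew i), neg_mul, mul_assoc, ← mul_assoc (τ 0), (hτ 0).2, one_mul]
  have hL : CliffordLists (List.ofFn fun i : Fin n => star (τ 0) * τ i.succ) [] := by
    refine ⟨?_, by simp, ?_, by simp, by simp⟩
    · rw [List.forall_mem_ofFn_iff]
      intro i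
      rw [hprod, (hτ _).1]
    · rw [List.pairwise_ofFn]
      intro i j hij
      have := hanti i.succ j.succ
      rw [if_neg (by simpa using hij.ne), zero_smul] at this
      rw [AntiCommute, hprod, hprod, neg_inj, eq_neg_iff_add_eq_zero, this]
  simpa using hL.tableM_dvd_finrank n (List.length_ofFn)

theorem CliffordSystems.tableM_dvd {m n : ℕ} (h : (CliffordSystems m (n + 2)).Nonempty) :
    tableM (n + 1) ∣ m := by
  obtain ⟨P, -, h⟩ := h
  simp only [← Module.End.mul_eq_comp, ← Module.End.one_eq_id] at h
  have hsq : ∀ i, P i * P i = 1 := fun i => by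
    have := h i i
    rw [if_pos rfl, ← two_smul ℝ] at this
    exact smul_right_injective _ two_ne_zero this
  have hanti : ∀ i j, i ≠ j → AntiCommute (P i) (P j) := fun i j hij => by
    rw [AntiCommute, eq_neg_iff_add_eq_zero, h, if_neg hij, zero_smul]
  have h01 : AntiCommute (P 1) (P 0) := hanti 1 0 (by simp)
  have h0 : ∀ i : Fin n, AntiCommute (P i.succ.succ) (P 0) := fun i =>
    hanti _ _ (Fin.succ_ne_zero _)
  have h1 : ∀ i : Fin n, AntiCommute (P 1) (P i.succ.succ) := fun i =>
    hanti _ _ (by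
      rw [← Fin.succ_zero_eq_one, Ne, Fin.succ_inj]
      exact (Fin.succ_ne_zero _).symm)
  obtain ⟨W, r, hW, hr1, hr⟩ := exists_compression (hsq 0)
    (⟨⟨P 1, P 1, hsq 1, hsq 1⟩, rfl⟩ : IsUnit (P 1)) h01
  have hprod : ∀ i j : Fin n, P 1 * P i.succ.succ * (P 1 * P j.succ.succ)
      = -(P i.succ.succ * P j.succ.succ) := fun i j => by
    rw [h1 i, neg_mul, mul_assoc, ← mul_assoc (P 1), hsq, one_mul]
  have hL : CliffordLists (List.ofFn fun i : Fin n => P 1 * P i.succ.succ) [] := by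
    refine ⟨?_, by simp, ?_, by simp, by simp⟩
    · rw [List.forall_mem_ofFn_iff]
      intro i
      rw [hprod, hsq]
    · rw [List.pairwise_ofFn]
      intro i j hij
      have := hanti i.succ.succ j.succ.succ (by simpa using hij.ne)
      rw [AntiCommute, hprod, hprod, this, neg_neg]
  -- Each `P₁ Pᵢ` commutes with `P₀`, so it acts on the `1`-eigenspace, whose dimension is `m`.
  have hLW := hL.map r.toAddMonoidHom hr1 fun x _ y hy => hr x y (by
    rw [List.append_nil, List.mem_ofFn] at hy
    obtain ⟨i, rfl⟩ := hy
    exact (h01.symm.mul_right (h0 i).symm).symm)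
  have := hLW.tableM_dvd_finrank n (by simp)
  rw [finrank_euclideanSpace_fin] at hW
  rwa [Nat.eq_of_mul_eq_mul_left two_pos hW]

theorem oSystems_nonempty_iff {m n : ℕ} : (OSystems m (n + 1)).Nonempty ↔ tableM (n + 1) ∣ m := by
  refine ⟨OSystems.tableM_dvd, ?_⟩
  rintro ⟨k, rfl⟩
  rw [mul_comm]
  exact (HasCliffordMatrices.of_mul_tableM n k).nonempty_oSystems

theorem cliffordSystems_nonempty_iff {m n : ℕ} :
    (CliffordSystems m (n + 2)).Nonempty ↔ tableM (n + 1) ∣ m := by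
  refine ⟨CliffordSystems.tableM_dvd, ?_⟩
  rintro ⟨k, rfl⟩
  rw [mul_comm _ k]
  exact (HasCliffordMatrices.of_mul_tableM n k).toSymmetric.nonempty_cliffordSystems

/-! ### Arithmetic of the table and Radon–Hurwitz numbers -/

theorem tableM_add_eight_mul (n d : ℕ) : tableM (n + 1 + 8 * d) = 2 ^ (4 * d) * tableM (n + 1) := by
  induction d with
  | zero => simp
  | succ d ih =>
    rw [show n + 1 + 8 * (d + 1) = n + 8 * d + 9 by ring, tableM,
      show n + 8 * d + 1 = n + 1 + 8 * d by ring, ih]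
    ring

theorem tableM_pos (n : ℕ) : 0 < tableM (n + 1) := by
  induction n using Nat.strong_induction_on with
  | _ n ih =>
    match n, ih with
    | 0, _ | 1, _ | 2, _ | 3, _ | 4, _ | 5, _ | 6, _ | 7, _ => simp [tableM]
    | n + 8, ih => exact Nat.mul_pos (by norm_num) (ih n (by omega))

theorem tableM_dvd_succ (n : ℕ) : tableM (n + 1) ∣ tableM (n + 2) := by
  induction n using Nat.strong_induction_on with
  | _ n ih =>
    match n, ih with
    | 0, _ | 1, _ | 2, _ | 3, _ | 4, _ | 5, _ | 6, _ | 7, _ => norm_num [tableM]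
    | n + 8, ih => exact Nat.mul_dvd_mul_left 16 (ih n (by omega))

theorem tableM_dvd_of_le {a b : ℕ} (h : a ≤ b) : tableM (a + 1) ∣ tableM (b + 1) := by
  induction b, h using Nat.le_induction with
  | base => exact dvd_rfl
  | succ b _ ih => exact ih.trans (tableM_dvd_succ b)

theorem tableM_radonHurwitz {c : ℕ} (d : ℕ) (hc : c ≤ 3) :
    tableM (2 ^ c + 8 * d) = 2 ^ (c + 4 * d) := by
  have := tableM_add_eight_mul (2 ^ c - 1) d
  rw [Nat.sub_add_cancel Nat.one_le_two_pow] at this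
  rw [this, add_comm c, pow_add]
  interval_cases c <;> simp [tableM]

/-- The table doubles just after the indices `1, 2, 4, 8` modulo the period; this makes `2^c + 8d`
maximal. -/
theorem tableM_radonHurwitz_succ {c : ℕ} (d : ℕ) (hc : c ≤ 3) :
    tableM (2 ^ c + 8 * d + 1) = 2 ^ (c + 4 * d + 1) := by
  rw [show 2 ^ c + 8 * d + 1 = 2 ^ c + 1 + 8 * d by ring, tableM_add_eight_mul,
    show c + 4 * d + 1 = 4 * d + (c + 1) by ring, pow_add]
  interval_cases c <;> simp [tableM]

/-- The Radon-Hurwitz number of `m` is the largest `k` for which the table entry divides `m`. -/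
theorem le_radonHurwitz_of_tableM_dvd {r c d k : ℕ} (hc : c ≤ 3)
    (h : tableM (k + 1) ∣ (2 * r + 1) * 2 ^ (c + 4 * d)) : k + 1 ≤ 2 ^ c + 8 * d := by
  -- Entries divide later ones, so a larger index would force an extra factor `2` into the odd
  -- number `2r + 1`.
  by_contra! hlt
  have h1 := (tableM_dvd_of_le (show 2 ^ c + 8 * d ≤ k by omega)).trans h
  rw [tableM_radonHurwitz_succ d hc, pow_succ', Nat.mul_dvd_mul_iff_right (by positivity)] at h1
  omega

theorem existsUnique_odd_mul_two_pow {m : ℕ} (hm : 0 < m) :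
    ∃! t : ℕ × ℕ × ℕ, t.2.1 ≤ 3 ∧ m = (2 * t.1 + 1) * 2 ^ (t.2.1 + 4 * t.2.2) := by
  obtain ⟨e, o, ⟨r, rfl⟩, rfl⟩ := Nat.exists_eq_two_pow_mul_odd hm.ne'
  refine ⟨(r, e % 4, e / 4), ⟨by dsimp only; omega, ?_⟩, ?_⟩
  · dsimp only
    rw [Nat.mod_add_div, mul_comm]
  · rintro ⟨r', c, d⟩ ⟨hc, h⟩
    dsimp only at hc h
    -- The `2`-adic valuation recovers `c + 4d`, and `c ≤ 3` makes this division by `4` with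
    -- remainder.
    have hval : ∀ a b : ℕ, padicValNat 2 ((2 * a + 1) * 2 ^ b) = b := fun a b => by
      rw [padicValNat.mul (by omega) (by positivity), padicValNat.prime_pow,
        padicValNat.eq_zero_of_not_dvd (by omega), zero_add]
    have he : e = c + 4 * d := by
      rw [← hval r e, mul_comm, h, hval]
    subst he
    rw [mul_comm] at h
    have := Nat.eq_of_mul_eq_mul_right (by positivity) h
    ext <;> dsimp only <;> omega

/-! ### Range-maximal and domain-minimal systems -/

theorem theorem4p3 :
    -- Part A: every positive `m` is uniquely `(2r + 1) 2^(c + 4d)` with `0 ≤ c ≤ 3`, and with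
    -- `σ(m) = 2^c + 8d` there are range-maximal systems
    (∀ m : ℕ, 0 < m →
      (∃! t : ℕ × ℕ × ℕ, t.2.1 ≤ 3 ∧ m = (2 * t.1 + 1) * 2 ^ (t.2.1 + 4 * t.2.2)) ∧
      ∀ r c d : ℕ, c ≤ 3 → m = (2 * r + 1) * 2 ^ (c + 4 * d) →
        (∃ τ, IsRangeMaximalO m (2 ^ c + 8 * d) τ) ∧
        (∃ P, IsRangeMaximalClifford m (2 ^ c + 8 * d + 1) P)) ∧
    -- Part B: domain-minimal systems exist for and only for the pairs `(m(n), n)` of the table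
    (∀ m n : ℕ, 0 < n →
      ((∃ P, IsDomainMinimalClifford m (n + 1) P) ↔ m = tableM n) ∧
      ((∃ τ, IsDomainMinimalO m n τ) ↔ m = tableM n)) := by
  refine ⟨fun m hm => ⟨existsUnique_odd_mul_two_pow hm, ?_⟩, ?_⟩
  · rintro r c d hc rfl
    have hdvd : tableM (2 ^ c + 8 * d) ∣ (2 * r + 1) * 2 ^ (c + 4 * d) := by
      rw [tableM_radonHurwitz d hc]
      exact dvd_mul_left _ _
    have hle : ∀ k, tableM (k + 1) ∣ (2 * r + 1) * 2 ^ (c + 4 * d) → k + 1 ≤ 2 ^ c + 8 * d :=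
      fun k => le_radonHurwitz_of_tableM_dvd hc
    obtain ⟨s, hs⟩ : ∃ s, 2 ^ c + 8 * d = s + 1 :=
      Nat.exists_eq_add_one_of_ne_zero (by positivity)
    rw [hs] at hdvd hle ⊢
    constructor
    · obtain ⟨τ, hτ⟩ := oSystems_nonempty_iff.2 hdvd
      refine ⟨τ, hτ, fun k hk => ?_⟩
      match k, hk with
      | 0, _ => omega
      | k + 1, hk => exact hle k (oSystems_nonempty_iff.1 hk)
    · obtain ⟨P, hP⟩ := cliffordSystems_nonempty_iff.2 hdvd
      refine ⟨P, hP, fun k hk => ?_⟩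
      match k, hk with
      -- The divisibility criterion starts at two operators; smaller `k` satisfy the bound
      -- trivially.
      | 0, _ | 1, _ => omega
      | k + 2, hk => exact Nat.succ_le_succ (hle k (cliffordSystems_nonempty_iff.1 hk))
  · intro m n hn
    obtain ⟨n, rfl⟩ := Nat.exists_eq_add_one_of_ne_zero hn.ne'
    have hpos := tableM_pos n
    constructor
    · constructor
      · rintro ⟨P, hm, hP, hmin⟩
        have h1 := Nat.le_of_dvd hm (cliffordSystems_nonempty_iff.1 ⟨P, hP⟩)
        have h2 := hmin _ hpos (cliffordSystems_nonempty_iff.2 dvd_rfl)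
        omega
      · rintro rfl
        obtain ⟨P, hP⟩ := cliffordSystems_nonempty_iff.2 (dvd_refl (tableM (n + 1)))
        exact ⟨P, hpos, hP, fun l hl h =>
          Nat.mul_le_mul_left 2 (Nat.le_of_dvd hl (cliffordSystems_nonempty_iff.1 h))⟩
    · constructor
      · rintro ⟨τ, hm, hτ, hmin⟩
        have h1 := Nat.le_of_dvd hm (oSystems_nonempty_iff.1 ⟨τ, hτ⟩)
        have h2 := hmin _ hpos (oSystems_nonempty_iff.2 dvd_rfl)
        omega
      · rintro rfl
        obtain ⟨τ, hτ⟩ := oSystems_nonempty_iff.2 (dvd_refl (tableM (n + 1)))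
        exact ⟨τ, hpos, hτ, fun l hl h => Nat.le_of_dvd hl (oSystems_nonempty_iff.1 h)⟩
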